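/- Let $\mathbb{T}=\mathbb{R}/2\pi\mathbb{Z}$ and let $(u_j)_{j}$ be a countable family of real-valued $C^\infty$ functions on $\mathbb{T}$ such that the series $$V(x,y)=\sum_{j}\bigl(u_j(y)-u_j(x)\bigr)^2$$ converges for every $(x,y)\in\mathbb{T}^2$. For $\lambda>0$ let $$L^\lambda=-\Delta+\lambda^2V \quad\text{on } L^2(\mathbb{T}^2),$$ where $\Delta=\partial_x^2+\partial_y^2$, be the Schrödinger operator defined as a form sum: its form domain is $Q=\{f\in H^1(\mathbb{T}^2):\int_{\mathbb{T}^2}V|f|^2<\infty\}$, and $L^\lambda f=h$ means that $f\in Q$, $h\in L^2(\mathbb{T}^2)$ and $\int_{\mathbb{T}^2}\bigl(\nabla f\cdot\overline{\nabla g}+\lambda^2Vf\overline g\bigr)\,dx\,dy=\int_{\mathbb{T}^2}h\overline g\,dx\,dy$ for all $g\in Q$. A number $\mu$ is an eigenvalue of $L^\lambda$ if $L^\lambda f=\mu f$ for some $f\neq0$. Suppose that each $u_j$ has only finitely many isolated critical points, and let $n_0\ge 0$ be an integer such that for every $x\in\mathbb{T}$ there exist an index $j$ and an integer $0\le n\le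 n_0$ with $u_j^{(n+1)}(x)\neq0$. Then there is a constant $c>0$ (independent of $\lambda$) such that, for all sufficiently large $\lambda$, the operator $L^\lambda$ has a smallest eigenvalue, and this smallest eigenvalue is at least $c\,\lambda^{\frac{2}{n_0+2}}$. -/

import Mathlib

open MeasureTheory Filter Topology
open scoped ContDiff ComplexConjugate

noncomputable section

namespace ShearSpectrum

/-- The one-dimensional torus `ℝ / 2πℤ`. -/
abbrev Torus : Type := AddCircle (2 * Real.pi)

instance : Fact (0 < 2 * Real.pi) := ⟨Real.two_pi_pos⟩

/-- The two-dimensional torus, with its Lebesgue measure `volume` (of total mass `4π²`). -/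
abbrev Torus2 : Type := Torus × Torus

/-- `f : 𝕋 → ℝ` is `C^∞`, i.e. its `2π`-periodic lift to `ℝ` is. -/
def SmoothOnTorus (f : Torus → ℝ) : Prop :=
  ContDiff ℝ ∞ (fun t : ℝ => f (t : Torus))

/-- The `n`-th derivative `f^{(n)}(x)` of a function on the torus. -/
def torusDeriv (n : ℕ) (f : Torus → ℝ) (x : Torus) : ℝ :=
  iteratedDeriv n (fun t : ℝ => f (x + (t : Torus))) 0

/-- `x` is an isolated critical point of `f`: `f'(x) = 0` and `f'` has no other zero near `x`. -/
def IsIsolatedCriticalPoint (f : Torus → ℝ) (x : Torus) : Prop :=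
  torusDeriv 1 f x = 0 ∧ ∀ᶠ z in 𝓝[≠] x, torusDeriv 1 f z ≠ 0

/-- The potential `V(x, y) = ∑_j (u_j(y) - u_j(x))²` on `𝕋²`. -/
def shearPotential {ι : Type*} (u : ι → Torus → ℝ) (p : Torus2) : ℝ :=
  ∑' j, (u j p.2 - u j p.1) ^ 2

/-- Smooth test functions on `𝕋²`: the doubly periodic lift to `ℝ²` is `C^∞`. -/
def IsTestFunction (φ : Torus2 → ℂ) : Prop :=
  ContDiff ℝ ∞ (fun q : ℝ × ℝ => φ ((q.1 : Torus), (q.2 : Torus)))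

/-- Classical partial derivative in the first variable. -/
def partial₁ (φ : Torus2 → ℂ) (p : Torus2) : ℂ :=
  deriv (fun t : ℝ => φ (p.1 + (t : Torus), p.2)) 0

/-- Classical partial derivative in the second variable. -/
def partial₂ (φ : Torus2 → ℂ) (p : Torus2) : ℂ :=
  deriv (fun t : ℝ => φ (p.1, p.2 + (t : Torus))) 0

/-- `f ∈ H¹(𝕋²)` with weak gradient `(f₁, f₂)`. -/
structure HasWeakGradient (f f₁ f₂ : Torus2 → ℂ) : Prop where
  memLp : MemLp f 2 volume
  memLp₁ : MemLp f₁ 2 volume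
  memLp₂ : MemLp f₂ 2 volume
  weak₁ : ∀ φ, IsTestFunction φ → ∫ p, f p * partial₁ φ p = - ∫ p, f₁ p * φ p
  weak₂ : ∀ φ, IsTestFunction φ → ∫ p, f p * partial₂ φ p = - ∫ p, f₂ p * φ p

/-- `f`, with weak gradient `(f₁, f₂)`, lies in the form domain `{f ∈ H¹(𝕋²) : ∫ W |f|² < ∞}` of
`-Δ + W`, where `W ≥ 0` is a potential on `𝕋²`. -/
def InFormDomain (W : Torus2 → ℝ) (f f₁ f₂ : Torus2 → ℂ) : Prop :=
  HasWeakGradient f f₁ f₂ ∧ Integrable (fun p => W p * ‖f p‖ ^ 2) volume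

/-- The graph of the Schrödinger operator `-Δ + W` on `L²(𝕋²)`, defined as a form sum:
`f` is in the operator domain and `(-Δ + W) f = h` if and only if `f` is in the form domain,
`h ∈ L²(𝕋²)`, and `∫ (∇f · conj ∇g + W f conj g) = ∫ h conj g` for all `g` in the form domain.
(Functions are considered up to almost everywhere equality; weak gradients are unique.) -/
def SchrodingerGraph (W : Torus2 → ℝ) (f h : Torus2 → ℂ) : Prop :=
  MemLp h 2 volume ∧ ∃ f₁ f₂ : Torus2 → ℂ, InFormDomain W f f₁ f₂ ∧
    ∀ g g₁ g₂ : Torus2 → ℂ, InFormDomain W g g₁ g₂ →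
      ∫ p, (f₁ p * conj (g₁ p) + f₂ p * conj (g₂ p) + (W p : ℂ) * f p * conj (g p)) =
        ∫ p, h p * conj (g p)

/-- `μ` is an eigenvalue of `-Δ + W`: there is `f ≠ 0` in `L²(𝕋²)` with `(-Δ + W) f = μ f`.
The operator is symmetric, so that all its eigenvalues are real. -/
def IsSchrodingerEigenvalue (W : Torus2 → ℝ) (μ : ℝ) : Prop :=
  ∃ f : Torus2 → ℂ, ¬ (f =ᵐ[volume] 0) ∧ SchrodingerGraph W f (fun p => (μ : ℂ) * f p)

end ShearSpectrum

end

/-!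
# A lower bound for the smallest eigenvalue of a Schrödinger operator with a shear potential

**The lower bound.** By compactness of `𝕋` and the mean value theorem for finite differences, there
is `c > 0` such that for all small `h` and all `x, y` the potential `V` is at least
`c h ^ (2 (n₀ + 1))` at one of the points `(x, y + k h)`, `0 ≤ k ≤ n₀ + 1`
(`exists_le_shearPotential_translate`): subtracting the constant `u_j(x)` does not change the finite
differences of `u_j`. Comparing `f (x, y)` with the value of `f` at that point and integrating over
the torus, which is invariant under translations, gives
`∫ |f|² ≤ C (h ^ (-2 (n₀ + 1)) ∫ V |f|² + h² ∫ |∂₂ f|²)` for every `f` in the form domain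
(`integral_norm_sq_le_of_exists_translate`). The differences `f (x, y + k h) - f (x, y)` are
estimated in `L²` by Parseval's identity. With `h = λ ^ (-1 / (n₀ + 2))` the right-hand side is
`C h²` times the energy of `f`, and `h ^ (-2) = λ ^ (2 / (n₀ + 2))`.

**Existence.** The form domain, with the form norm, is a Hilbert space, and its inclusion `J` into
`L²` is compact, since the Fourier coefficients of an `H¹` function decay. A compact operator
attains its norm at an eigenvector of `J* J` (`exists_inner_eq_of_isCompactOperator`), and this is an
eigenfunction for the smallest eigenvalue `‖J‖⁻² - 1`
(`exists_isLeast_isSchrodingerEigenvalue`). This requires the form domain to be nonzero: `V` is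
finite and lower semicontinuous, so that by Baire's theorem it is bounded on some nonempty open set,
which supports a nonzero test function.
-/

noncomputable section

namespace ShearSpectrum

/-! ### Test functions on the two-dimensional torus -/

lemma isOpenQuotientMap_coe_torus2 :
    IsOpenQuotientMap (fun q : ℝ × ℝ => (((q.1 : Torus), (q.2 : Torus)) : Torus2)) :=
  IsOpenQuotientMap.prodMap (f := ((↑) : ℝ → Torus)) (g := ((↑) : ℝ → Torus))
    QuotientAddGroup.isOpenQuotientMap_mk QuotientAddGroup.isOpenQuotientMap_mk

lemma exists_coe_torus2 (p : Torus2) : ∃ q : ℝ × ℝ, p = ((q.1 : Torus), (q.2 : Torus)) := by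
  obtain ⟨q, hq⟩ := isOpenQuotientMap_coe_torus2.surjective p
  exact ⟨q, hq.symm⟩

lemma IsTestFunction.continuous {φ : Torus2 → ℂ} (hφ : IsTestFunction φ) : Continuous φ :=
  isOpenQuotientMap_coe_torus2.continuous_comp_iff.1 (ContDiff.continuous hφ)

lemma IsTestFunction.mul {φ ψ : Torus2 → ℂ} (hφ : IsTestFunction φ) (hψ : IsTestFunction ψ) :
    IsTestFunction (fun p => φ p * ψ p) :=
  ContDiff.mul hφ hψ

lemma IsTestFunction.swap {φ : Torus2 → ℂ} (hφ : IsTestFunction φ) :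
    IsTestFunction (fun p => φ p.swap) :=
  ContDiff.comp (g := fun q : ℝ × ℝ => φ ((q.1 : Torus), (q.2 : Torus))) hφ
    (contDiff_snd.prodMk contDiff_fst)

lemma partial₂_eq_partial₁_swap (φ : Torus2 → ℂ) (p : Torus2) :
    partial₂ φ p = partial₁ (fun p => φ p.swap) p.swap := rfl

lemma IsTestFunction.hasDerivAt_coe {φ : Torus2 → ℂ} (hφ : IsTestFunction φ) (b t : ℝ) :
    HasDerivAt (fun s : ℝ => φ ((s : Torus), (b : Torus)))
      (fderiv ℝ (fun q : ℝ × ℝ => φ ((q.1 : Torus), (q.2 : Torus))) (t, b) (1, 0)) t := by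
  have h1 : HasFDerivAt (fun q : ℝ × ℝ => φ ((q.1 : Torus), (q.2 : Torus)))
      (fderiv ℝ (fun q : ℝ × ℝ => φ ((q.1 : Torus), (q.2 : Torus))) (t, b)) (t, b) :=
    ((ContDiff.differentiable hφ (by simp)) (t, b)).hasFDerivAt
  exact h1.comp_hasDerivAt t ((hasDerivAt_id t).prodMk (hasDerivAt_const t b))

lemma IsTestFunction.partial₁_coe {φ : Torus2 → ℂ} (hφ : IsTestFunction φ) (q : ℝ × ℝ) :
    partial₁ φ ((q.1 : Torus), (q.2 : Torus)) =
      fderiv ℝ (fun q : ℝ × ℝ => φ ((q.1 : Torus), (q.2 : Torus))) q (1, 0) := by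
  have h := (hφ.hasDerivAt_coe q.2 (q.1 + 0)).comp_const_add q.1 0
  simp only [add_zero, AddCircle.coe_add] at h
  exact h.deriv

lemma IsTestFunction.hasDerivAt_partial₁ {φ : Torus2 → ℂ} (hφ : IsTestFunction φ) (y : Torus)
    (t : ℝ) : HasDerivAt (fun s : ℝ => φ ((s : Torus), y)) (partial₁ φ ((t : Torus), y)) t := by
  obtain ⟨b, rfl⟩ := QuotientAddGroup.mk_surjective y
  have := hφ.hasDerivAt_coe b t
  rw [← hφ.partial₁_coe (t, b)] at this
  exact this

lemma IsTestFunction.partial₁ {φ : Torus2 → ℂ} (hφ : IsTestFunction φ) :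
    IsTestFunction (partial₁ φ) := by
  have : (fun q : ℝ × ℝ => ShearSpectrum.partial₁ φ ((q.1 : Torus), (q.2 : Torus))) = fun q =>
      fderiv ℝ (fun q : ℝ × ℝ => φ ((q.1 : Torus), (q.2 : Torus))) q (1, 0) :=
    funext hφ.partial₁_coe
  unfold IsTestFunction
  rw [this]
  exact (ContDiff.fderiv_right (m := ∞) hφ (by simp)).clm_apply contDiff_const

lemma IsTestFunction.partial₂ {φ : Torus2 → ℂ} (hφ : IsTestFunction φ) :
    IsTestFunction (partial₂ φ) :=
  hφ.swap.partial₁.swap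

lemma IsTestFunction.memLp {φ : Torus2 → ℂ} (hφ : IsTestFunction φ) : MemLp φ 2 volume :=
  hφ.continuous.memLp_of_hasCompactSupport (HasCompactSupport.of_compactSpace _)

lemma IsTestFunction.integrable {φ : Torus2 → ℂ} (hφ : IsTestFunction φ) :
    Integrable φ volume :=
  hφ.continuous.integrable_of_hasCompactSupport (HasCompactSupport.of_compactSpace _)

lemma IsTestFunction.partial₁_mul {φ ψ : Torus2 → ℂ} (hφ : IsTestFunction φ)
    (hψ : IsTestFunction ψ) (p : Torus2) :
    ShearSpectrum.partial₁ (fun p => φ p * ψ p) p =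
      ShearSpectrum.partial₁ φ p * ψ p + φ p * ShearSpectrum.partial₁ ψ p := by
  obtain ⟨⟨a, b⟩, rfl⟩ := exists_coe_torus2 p
  exact ((hφ.mul hψ).hasDerivAt_partial₁ b a).unique
    ((hφ.hasDerivAt_partial₁ b a).mul (hψ.hasDerivAt_partial₁ b a))

/-- Fubini's theorem and the fundamental theorem of calculus over one period. -/
lemma IsTestFunction.integral_partial₁ {φ : Torus2 → ℂ} (hφ : IsTestFunction φ) :
    ∫ p, ShearSpectrum.partial₁ φ p = 0 := by
  have hi := hφ.partial₁.integrable
  rw [Measure.volume_eq_prod] at hi ⊢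
  rw [integral_prod_symm _ hi]
  refine integral_eq_zero_of_ae (Eventually.of_forall fun y => ?_)
  have hc : Continuous fun s : ℝ => ShearSpectrum.partial₁ φ ((s : Torus), y) :=
    hφ.partial₁.continuous.comp ((AddCircle.continuous_mk' _).prodMk continuous_const)
  change ∫ x : Torus, ShearSpectrum.partial₁ φ (x, y) = 0
  rw [← AddCircle.intervalIntegral_preimage (2 * Real.pi) 0,
    intervalIntegral.integral_eq_sub_of_hasDerivAt (fun t _ => hφ.hasDerivAt_partial₁ y t)
      (hc.intervalIntegrable _ _), zero_add, AddCircle.coe_period, AddCircle.coe_zero, sub_self]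

lemma integral_comp_swap_torus2 (F : Torus2 → ℂ) : ∫ p : Torus2, F p.swap = ∫ p, F p :=
  (Measure.measurePreserving_swap (μ := (volume : Measure Torus))
    (ν := (volume : Measure Torus))).integral_comp MeasurableEquiv.prodComm.measurableEmbedding F

lemma IsTestFunction.integral_mul_partial₁ {φ ψ : Torus2 → ℂ} (hφ : IsTestFunction φ)
    (hψ : IsTestFunction ψ) :
    ∫ p, φ p * ShearSpectrum.partial₁ ψ p = -∫ p, ShearSpectrum.partial₁ φ p * ψ p := by
  have h := (hφ.mul hψ).integral_partial₁
  simp only [hφ.partial₁_mul hψ] at h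
  rw [integral_add (hφ.partial₁.mul hψ).integrable (hφ.mul hψ.partial₁).integrable] at h
  exact eq_neg_of_add_eq_zero_right h

lemma IsTestFunction.hasWeakGradient {φ : Torus2 → ℂ} (hφ : IsTestFunction φ) :
    HasWeakGradient φ (ShearSpectrum.partial₁ φ) (ShearSpectrum.partial₂ φ) where
  memLp := hφ.memLp
  memLp₁ := hφ.partial₁.memLp
  memLp₂ := hφ.partial₂.memLp
  weak₁ ψ hψ := hφ.integral_mul_partial₁ hψ
  weak₂ ψ hψ := by
    have h := hφ.swap.integral_mul_partial₁ hψ.swap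
    rw [← integral_comp_swap_torus2, ← integral_comp_swap_torus2 (fun p => _ * ψ p.swap)] at h
    exact h

/-! ### Fourier series on the two-dimensional torus -/

/-- The character `(x, y) ↦ exp (i (k₁ x + k₂ y))` of `𝕋²`. -/
def character (k : ℤ × ℤ) : C(Torus2, ℂ) where
  toFun p := fourier k.1 p.1 * fourier k.2 p.2

lemma character_apply (k : ℤ × ℤ) (p : Torus2) :
    character k p = fourier k.1 p.1 * fourier k.2 p.2 := rfl

lemma character_neg (k : ℤ × ℤ) (p : Torus2) : character (-k) p = conj (character k p) := by
  simp [character_apply]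

lemma character_add (k l : ℤ × ℤ) (p : Torus2) :
    character (k + l) p = character k p * character l p := by
  simp only [character_apply, Prod.fst_add, Prod.snd_add, fourier_add]
  ring

lemma hasDerivAt_fourier_torus (n : ℤ) (x : ℝ) :
    HasDerivAt (fun y : ℝ => fourier n (y : Torus)) (Complex.I * n * fourier n (x : Torus)) x := by
  convert! hasDerivAt_fourier (2 * Real.pi) n x using 2
  have : (Real.pi : ℂ) ≠ 0 := by exact_mod_cast Real.pi_ne_zero
  push_cast
  field_simp

lemma contDiff_fourier_torus (n : ℤ) : ContDiff ℝ ∞ (fun y : ℝ => fourier n (y : Torus)) := by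
  simp only [fourier_coe_apply]
  have : ContDiff ℝ ∞ (fun y : ℝ => (y : ℂ)) := Complex.ofRealCLM.contDiff
  fun_prop

lemma isTestFunction_character (k : ℤ × ℤ) : IsTestFunction (character k) :=
  ((contDiff_fourier_torus k.1).comp contDiff_fst).mul
    ((contDiff_fourier_torus k.2).comp contDiff_snd)

lemma partial₁_character (k : ℤ × ℤ) (p : Torus2) :
    partial₁ (character k) p = Complex.I * k.1 * character k p := by
  obtain ⟨⟨a, b⟩, rfl⟩ := exists_coe_torus2 p
  have h := (hasDerivAt_fourier_torus k.1 a).mul_const (fourier k.2 (b : Torus))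
  rw [((isTestFunction_character k).hasDerivAt_partial₁ b a).unique h, character_apply]
  ring

lemma partial₂_character (k : ℤ × ℤ) (p : Torus2) :
    partial₂ (character k) p = Complex.I * k.2 * character k p := by
  have h : (fun p : Torus2 => character k p.swap) = character k.swap := by
    ext p
    simp [character_apply, mul_comm]
  rw [partial₂_eq_partial₁_swap, h, partial₁_character, ← h]
  simp

lemma character_add_right (k : ℤ × ℤ) (p : Torus2) (h : ℝ) :
    character k (p.1, p.2 + (h : Torus)) =
      Complex.exp (Complex.I * (k.2 * h : ℝ)) * character k p := by
  have : (Real.pi : ℂ) ≠ 0 := by exact_mod_cast Real.pi_ne_zero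
  simp only [character_apply]
  rw [fourier_apply (x := p.2 + (h : Torus)), smul_add, AddCircle.toCircle_add, Circle.coe_mul,
    ← fourier_apply, ← fourier_apply, fourier_coe_apply]
  have e : 2 * (Real.pi : ℂ) * Complex.I * k.2 * h / ((2 * Real.pi : ℝ) : ℂ)
      = Complex.I * (k.2 * h : ℝ) := by
    push_cast
    field_simp
  rw [e]
  ring

lemma integral_fourier_torus (n : ℤ) :
    ∫ x : Torus, fourier n x = if n = 0 then ((2 * Real.pi : ℝ) : ℂ) else 0 := by
  split_ifs with hn
  · subst hn
    simp [Measure.real, AddCircle.measure_univ, Real.pi_nonneg]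
  · have hc : Continuous fun s : ℝ => Complex.I * n * fourier n (s : Torus) := by
      have := (contDiff_fourier_torus n).continuous
      fun_prop
    have h : ∫ x : Torus, Complex.I * n * fourier n x = 0 := by
      rw [← AddCircle.intervalIntegral_preimage (2 * Real.pi) 0,
        intervalIntegral.integral_eq_sub_of_hasDerivAt (fun t _ => hasDerivAt_fourier_torus n t)
        (hc.intervalIntegrable _ _), zero_add, AddCircle.coe_period, AddCircle.coe_zero, sub_self]
    rw [integral_const_mul] at h
    simpa [hn] using h

lemma integral_character (k : ℤ × ℤ) :
    ∫ p, character k p = if k = 0 then ((2 * Real.pi) ^ 2 : ℂ) else 0 := by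
  simp only [character_apply]
  rw [Measure.volume_eq_prod, integral_prod_mul (fun x : Torus => fourier k.1 x)
    (fun y : Torus => fourier k.2 y), integral_fourier_torus, integral_fourier_torus]
  simp only [Prod.ext_iff, Prod.fst_zero, Prod.snd_zero]
  split_ifs <;> simp_all [sq]

/-- The normalised characters as elements of `L²(𝕋²)`. -/
def characterLp (k : ℤ × ℤ) : Lp ℂ 2 (volume : Measure Torus2) :=
  ((2 * Real.pi : ℂ)⁻¹) • ContinuousMap.toLp 2 volume ℂ (character k)

lemma orthonormal_characterLp : Orthonormal ℂ characterLp := by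
  rw [orthonormal_iff_ite]
  intro k l
  have hpi : (Real.pi : ℂ) ≠ 0 := by exact_mod_cast Real.pi_ne_zero
  simp only [characterLp, inner_smul_left, inner_smul_right, ContinuousMap.inner_toLp,
    ← character_neg, ← character_add, integral_character]
  have e : l + -k = 0 ↔ k = l := by rw [add_neg_eq_zero, eq_comm]
  simp only [e]
  split_ifs
  · simp only [map_inv₀, map_mul, Complex.conj_ofReal, map_ofNat]
    field_simp
  · simp

/-- The trigonometric polynomials, as a star subalgebra of `C(𝕋², ℂ)`. -/
def trigSubalgebra : StarSubalgebra ℂ C(Torus2, ℂ) where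
  toSubalgebra := Algebra.adjoin ℂ (Set.range character)
  star_mem' := by
    change Algebra.adjoin ℂ (Set.range character) ≤ star (Algebra.adjoin ℂ (Set.range character))
    refine Algebra.adjoin_le ?_
    rintro _ ⟨n, rfl⟩
    refine Algebra.subset_adjoin ⟨-n, ?_⟩
    ext1 x
    simp only [character_neg, starRingEnd_apply, ContinuousMap.star_apply]

lemma trigSubalgebra_coe :
    trigSubalgebra.toSubalgebra.toSubmodule = Submodule.span ℂ (Set.range character) := by
  apply Algebra.adjoin_eq_span_of_subset
  refine .trans (fun x => Submonoid.closure_induction (fun _ => id) ⟨0, ?_⟩ ?_)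
    Submodule.subset_span
  · ext z
    simp [character_apply]
  · rintro _ _ _ _ ⟨m, rfl⟩ ⟨n, rfl⟩
    exact ⟨m + n, by ext z; simp [character_add]⟩

lemma trigSubalgebra_separatesPoints : trigSubalgebra.SeparatesPoints := by
  intro x y hxy
  have hT : (2 * Real.pi) ≠ 0 := Real.two_pi_pos.ne'
  by_cases h1 : x.1 = y.1
  · have h2 : x.2 ≠ y.2 := fun h2 => hxy (Prod.ext h1 h2)
    refine ⟨_, ⟨character (0, 1), Algebra.subset_adjoin ⟨_, rfl⟩, rfl⟩, ?_⟩
    intro h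
    apply h2
    simp only [character_apply, fourier_zero, fourier_one, one_mul] at h
    exact AddCircle.injective_toCircle hT (Subtype.coe_injective h)
  · refine ⟨_, ⟨character (1, 0), Algebra.subset_adjoin ⟨_, rfl⟩, rfl⟩, ?_⟩
    intro h
    apply h1
    simp only [character_apply, fourier_zero, fourier_one, mul_one] at h
    exact AddCircle.injective_toCircle hT (Subtype.coe_injective h)

lemma span_character_closure_eq_top :
    (Submodule.span ℂ (Set.range character)).topologicalClosure = ⊤ := by
  rw [← trigSubalgebra_coe]
  exact congr_arg (Subalgebra.toSubmodule <| StarSubalgebra.toSubalgebra ·)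
    (ContinuousMap.starSubalgebra_topologicalClosure_eq_top_of_separatesPoints _
      trigSubalgebra_separatesPoints)

lemma span_characterLp_closure_eq_top :
    (Submodule.span ℂ (Set.range characterLp)).topologicalClosure = ⊤ := by
  have h : (Submodule.span ℂ (Set.range fun k =>
      ContinuousMap.toLp (E := ℂ) 2 (volume : Measure Torus2) ℂ (character k))).topologicalClosure
      = ⊤ := by
    simpa only [Submodule.map_span, ContinuousLinearMap.coe_coe, ← Set.range_comp,
      Function.comp_def] using
      (ContinuousMap.toLp_denseRange ℂ (volume : Measure Torus2) ℂ
        (by simp)).topologicalClosure_map_submodule span_character_closure_eq_top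
  rw [← top_le_iff, ← h]
  refine Submodule.topologicalClosure_mono (Submodule.span_le.2 ?_)
  rintro _ ⟨k, rfl⟩
  have hpi : (2 * Real.pi : ℂ) ≠ 0 := by exact_mod_cast Real.two_pi_pos.ne'
  have := Submodule.smul_mem _ (2 * Real.pi : ℂ)
    (Submodule.subset_span (R := ℂ) (Set.mem_range_self (f := characterLp) k))
  rwa [characterLp, smul_smul, mul_inv_cancel₀ hpi, one_smul] at this

/-- The normalised characters form a Hilbert basis of `L²(𝕋²)`. -/
def characterBasis : HilbertBasis (ℤ × ℤ) ℂ (Lp ℂ 2 (volume : Measure Torus2)) :=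
  HilbertBasis.mk orthonormal_characterLp span_characterLp_closure_eq_top.ge

lemma coe_characterBasis : ⇑characterBasis = characterLp := HilbertBasis.coe_mk _ _

lemma inner_characterBasis (k : ℤ × ℤ) {f : Torus2 → ℂ} (hf : MemLp f 2 volume) :
    inner ℂ (characterBasis k) (hf.toLp f) =
      (2 * Real.pi : ℂ)⁻¹ * ∫ p, f p * character (-k) p := by
  rw [coe_characterBasis, characterLp, inner_smul_left, L2.inner_def]
  congr 1
  · simp only [map_inv₀, map_mul, Complex.conj_ofReal, map_ofNat]
  · refine integral_congr_ae ?_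
    filter_upwards [hf.coeFn_toLp, ContinuousMap.coeFn_toLp (𝕜 := ℂ) (p := 2) volume (character k)]
      with p h1 h2
    rw [h1, h2, character_neg]
    simp

lemma inner_self_eq_ofReal {E : Type*} [SeminormedAddCommGroup E] [InnerProductSpace ℂ E] (x : E) :
    inner ℂ x x = ((‖x‖ ^ 2 : ℝ) : ℂ) := by
  rw [inner_self_eq_norm_sq_to_K, Complex.ofReal_pow]
  rfl

lemma norm_toLp_sq {f : Torus2 → ℂ} (hf : MemLp f 2 volume) :
    ‖hf.toLp f‖ ^ 2 = ∫ p, ‖f p‖ ^ 2 := by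
  have h : ((‖hf.toLp f‖ ^ 2 : ℝ) : ℂ) = ((∫ p, ‖f p‖ ^ 2 : ℝ) : ℂ) := by
    rw [← inner_self_eq_ofReal, L2.inner_def, ← integral_complex_ofReal]
    refine integral_congr_ae ?_
    filter_upwards [hf.coeFn_toLp] with p h1
    rw [h1, inner_self_eq_ofReal]
  exact_mod_cast h

lemma hasSum_characterBasis (x : Lp ℂ 2 (volume : Measure Torus2)) :
    HasSum (fun k => ‖inner ℂ (characterBasis k) x‖ ^ 2) (‖x‖ ^ 2) := by
  have h := characterBasis.hasSum_inner_mul_inner x x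
  rw [inner_self_eq_ofReal] at h
  have e : ∀ k, inner ℂ x (characterBasis k) * inner ℂ (characterBasis k) x =
      ((‖inner ℂ (characterBasis k) x‖ ^ 2 : ℝ) : ℂ) := by
    intro k
    rw [← inner_conj_symm x, RCLike.conj_mul]
    simp
  simp only [e] at h
  exact Complex.hasSum_ofReal.1 h

lemma HasWeakGradient.inner_characterBasis₁ {f f₁ f₂ : Torus2 → ℂ} (h : HasWeakGradient f f₁ f₂)
    (k : ℤ × ℤ) : inner ℂ (characterBasis k) (h.memLp₁.toLp f₁) =
      Complex.I * k.1 * inner ℂ (characterBasis k) (h.memLp.toLp f) := by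
  have hw := h.weak₁ _ (isTestFunction_character (-k))
  rw [← neg_eq_iff_eq_neg, eq_comm] at hw
  rw [inner_characterBasis, inner_characterBasis, hw]
  simp only [partial₁_character, mul_left_comm (f _), integral_const_mul]
  simp
  ring

lemma HasWeakGradient.inner_characterBasis₂ {f f₁ f₂ : Torus2 → ℂ} (h : HasWeakGradient f f₁ f₂)
    (k : ℤ × ℤ) : inner ℂ (characterBasis k) (h.memLp₂.toLp f₂) =
      Complex.I * k.2 * inner ℂ (characterBasis k) (h.memLp.toLp f) := by
  have hw := h.weak₂ _ (isTestFunction_character (-k))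
  rw [← neg_eq_iff_eq_neg, eq_comm] at hw
  rw [inner_characterBasis, inner_characterBasis, hw]
  simp only [partial₂_character, mul_left_comm (f _), integral_const_mul]
  simp
  ring

/-! ### Translations of Sobolev functions -/

lemma measurePreserving_add_snd (h : ℝ) :
    MeasurePreserving (fun p : Torus2 => ((p.1, p.2 + (h : Torus)) : Torus2)) volume volume := by
  exact (MeasurePreserving.id (volume : Measure Torus)).prod
    (measurePreserving_add_right (volume : Measure Torus) (h : Torus))

lemma integral_comp_add_snd {E : Type*} [NormedAddCommGroup E] [NormedSpace ℝ E]
    (h : ℝ) (F : Torus2 → E) : ∫ p : Torus2, F (p.1, p.2 + (h : Torus)) = ∫ p, F p := by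
  refine (measurePreserving_add_snd h).integral_comp ?_ F
  exact ((Homeomorph.refl Torus).prodCongr
    (Homeomorph.addRight (h : Torus))).measurableEmbedding

lemma inner_characterBasis_translate (k : ℤ × ℤ) {f : Torus2 → ℂ} (hf : MemLp f 2 volume)
    (h : ℝ) (hf' : MemLp (fun p : Torus2 => f (p.1, p.2 + (h : Torus))) 2 volume) :
    inner ℂ (characterBasis k) (hf'.toLp _) =
      Complex.exp (Complex.I * (k.2 * h : ℝ)) * inner ℂ (characterBasis k) (hf.toLp f) := by
  rw [inner_characterBasis, inner_characterBasis, mul_left_comm]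
  congr 1
  rw [← integral_comp_add_snd h (fun p => f p * character (-k) p), ← integral_const_mul]
  refine integral_congr_ae (Eventually.of_forall fun p => ?_)
  simp only [character_add_right]
  have : Complex.exp (Complex.I * (k.2 * h : ℝ)) *
      Complex.exp (Complex.I * ((-k).2 * h : ℝ)) = 1 := by
    rw [← Complex.exp_add, ← Complex.exp_zero]
    congr 1
    push_cast
    simp
  linear_combination (-(f (p.1, p.2 + (h : Torus)) * character (-k) p)) * this

/-- The difference quotients of an `H¹` function are controlled by its weak derivative: on the
Fourier side this is `|exp (i k h) - 1| ≤ |k h|`. -/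
lemma HasWeakGradient.integral_norm_translate_sub_sq_le {f f₁ f₂ : Torus2 → ℂ}
    (hf : HasWeakGradient f f₁ f₂) (h : ℝ) :
    ∫ p : Torus2, ‖f (p.1, p.2 + (h : Torus)) - f p‖ ^ 2 ≤ h ^ 2 * ∫ p, ‖f₂ p‖ ^ 2 := by
  have hτ : MemLp (fun p : Torus2 => f (p.1, p.2 + (h : Torus))) 2 volume :=
    hf.memLp.comp_measurePreserving (measurePreserving_add_snd h)
  have h1 : ∫ p : Torus2, ‖f (p.1, p.2 + (h : Torus)) - f p‖ ^ 2 =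
      ‖hτ.toLp _ - hf.memLp.toLp f‖ ^ 2 := by
    rw [← MemLp.toLp_sub, norm_toLp_sq]
    rfl
  rw [h1, ← norm_toLp_sq hf.memLp₂]
  refine hasSum_le (fun k => ?_) (hasSum_characterBasis _)
    ((hasSum_characterBasis (hf.memLp₂.toLp f₂)).mul_left (h ^ 2))
  rw [inner_sub_right, inner_characterBasis_translate k hf.memLp h hτ, hf.inner_characterBasis₂,
    ← sub_one_mul, norm_mul, norm_mul, mul_pow, mul_pow, ← mul_assoc]
  gcongr
  have := Real.norm_exp_I_mul_ofReal_sub_one_le (x := k.2 * h)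
  calc ‖Complex.exp (Complex.I * (k.2 * h : ℝ)) - 1‖ ^ 2 ≤ ‖(k.2 * h : ℝ)‖ ^ 2 := by gcongr
    _ = h ^ 2 * ‖Complex.I * (k.2 : ℂ)‖ ^ 2 := by
      simp [mul_pow]
      ring

/-! ### Compact operators attain their norm -/

/-- A nonzero compact operator `J` between Hilbert spaces attains its norm at an eigenvector of
`J* J`. A maximising sequence is an approximate eigenvector of `J* J`, and compactness makes it
converge. -/
lemma exists_inner_eq_of_isCompactOperator {H K : Type*} [NormedAddCommGroup H]
    [InnerProductSpace ℂ H] [CompleteSpace H] [NormedAddCommGroup K] [InnerProductSpace ℂ K]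
    [CompleteSpace K] {J : H →L[ℂ] K} (hJ : IsCompactOperator J) (hJ0 : J ≠ 0) :
    ∃ x, J x ≠ 0 ∧ ∀ g, inner ℂ (J g) (J x) = (‖J‖ : ℂ) ^ 2 * inner ℂ g x := by
  have hpos : 0 < ‖J‖ := norm_pos_iff.2 hJ0
  have hex : ∀ n : ℕ, ∃ x : H, ‖x‖ < 1 ∧ ‖J‖ - 1 / ((n : ℝ) + 1) < ‖J x‖ := fun n =>
    J.exists_lt_apply_of_lt_opNorm (sub_lt_self _ Nat.one_div_pos_of_nat)
  choose x hx1 hx2 using hex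
  obtain ⟨S, hS, hSsub⟩ :=
    IsCompactOperator.image_closedBall_subset_compact (f := J.toLinearMap) hJ 1
  obtain ⟨y, -, σ, hσ, hy⟩ := hS.tendsto_subseq (x := fun n => J (x n))
    (fun n => hSsub ⟨x n, by simpa using (hx1 n).le, rfl⟩)
  have hle : ∀ n, ‖J (x n)‖ ≤ ‖J‖ := fun n => J.unit_le_opNorm _ (hx1 n).le
  have hnorm : Tendsto (fun n => ‖J (x n)‖) atTop (𝓝 ‖J‖) := by
    refine tendsto_of_tendsto_of_tendsto_of_le_of_le ?_ tendsto_const_nhds (fun n => (hx2 n).le) hle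
    simpa using tendsto_const_nhds.sub (tendsto_one_div_add_atTop_nhds_zero_nat (𝕜 := ℝ))
  set A := ContinuousLinearMap.adjoint J with hA
  -- a maximising sequence consists of approximate eigenvectors
  have hbound : ∀ n, ‖A (J (x n)) - ((‖J‖ ^ 2 : ℝ) : ℂ) • x n‖ ^ 2 ≤
      ‖J‖ ^ 2 * (‖J‖ ^ 2 - ‖J (x n)‖ ^ 2) := by
    intro n
    have h1 : ‖A (J (x n))‖ ≤ ‖J‖ * ‖J (x n)‖ := by
      have := A.le_opNorm (J (x n))
      rwa [hA, LinearIsometryEquiv.norm_map] at this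
    have h2 : RCLike.re (inner ℂ (A (J (x n))) (((‖J‖ ^ 2 : ℝ) : ℂ) • x n)) =
        ‖J‖ ^ 2 * ‖J (x n)‖ ^ 2 := by
      rw [inner_smul_right, hA, ContinuousLinearMap.adjoint_inner_left,
        inner_self_eq_ofReal, ← Complex.ofReal_mul]
      exact Complex.ofReal_re _
    rw [norm_sub_sq (𝕜 := ℂ), h2, norm_smul, Complex.norm_real, Real.norm_eq_abs,
      abs_of_nonneg (sq_nonneg _)]
    have h3 : ‖A (J (x n))‖ ^ 2 ≤ (‖J‖ * ‖J (x n)‖) ^ 2 := by gcongr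
    have h4 : (‖J‖ ^ 2 * ‖x n‖) ^ 2 ≤ (‖J‖ ^ 2 * 1) ^ 2 := by
      gcongr
      exact (hx1 n).le
    nlinarith
  have hzero : Tendsto (fun n => A (J (x n)) - ((‖J‖ ^ 2 : ℝ) : ℂ) • x n) atTop (𝓝 0) := by
    rw [tendsto_zero_iff_norm_tendsto_zero]
    have hsq : Tendsto (fun n => ‖A (J (x n)) - ((‖J‖ ^ 2 : ℝ) : ℂ) • x n‖ ^ 2) atTop (𝓝 0) := by
      refine squeeze_zero (fun n => sq_nonneg _) hbound ?_
      have := (tendsto_const_nhds (x := ‖J‖ ^ 2)).mul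
        ((tendsto_const_nhds (x := ‖J‖ ^ 2)).sub (hnorm.pow 2))
      simpa using this
    simpa [Real.sqrt_sq] using hsq.sqrt
  have hc : ((‖J‖ ^ 2 : ℝ) : ℂ) ≠ 0 := by exact_mod_cast (pow_pos hpos 2).ne'
  -- `A (J xₙ) → A y` along the subsequence, hence `xₙ → ‖J‖⁻² A y`
  set z := (((‖J‖ ^ 2 : ℝ) : ℂ))⁻¹ • A y with hz
  have hxz : Tendsto (fun n => x (σ n)) atTop (𝓝 z) := by
    have h := ((A.continuous.tendsto y).comp hy).sub (hzero.comp hσ.tendsto_atTop)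
    have h' := h.const_smul (((‖J‖ ^ 2 : ℝ) : ℂ))⁻¹
    simp only [Function.comp_def, sub_sub_cancel, smul_smul, inv_mul_cancel₀ hc, one_smul,
      sub_zero] at h'
    exact h'
  have hJz : J z = y := tendsto_nhds_unique ((J.continuous.tendsto z).comp hxz) hy
  refine ⟨z, ?_, fun g => ?_⟩
  · have : ‖J z‖ = ‖J‖ := tendsto_nhds_unique
      (((J.continuous.tendsto z).comp hxz).norm) (hnorm.comp hσ.tendsto_atTop)
    rw [← norm_pos_iff, this]
    exact hpos
  · rw [hJz, ← ContinuousLinearMap.adjoint_inner_right, ← hA, hz, inner_smul_right,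
      ← Complex.ofReal_pow, mul_inv_cancel_left₀ hc]

/-! ### The form domain as a Hilbert space -/

/-- The conjugate of a test function, as an element of `L²(𝕋²)`: pairing with it integrates
against the test function. -/
def IsTestFunction.conjLp {φ : Torus2 → ℂ} (hφ : IsTestFunction φ) :
    Lp ℂ 2 (volume : Measure Torus2) :=
  hφ.memLp.star.toLp (star φ)

lemma IsTestFunction.inner_conjLp {φ : Torus2 → ℂ} (hφ : IsTestFunction φ)
    (F : Lp ℂ 2 (volume : Measure Torus2)) : inner ℂ hφ.conjLp F = ∫ p, F p * φ p := by
  rw [L2.inner_def]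
  refine integral_congr_ae ?_
  filter_upwards [hφ.memLp.star.coeFn_toLp] with p hp
  rw [IsTestFunction.conjLp, hp]
  simp

/-- The form domain of `-Δ + W` as a subspace of `L²(𝕋²)⁴`: the quadruples
`(f, ∂₁ f, ∂₂ f, √W f)`. The norm that it inherits is the form norm
`(‖f‖² + ‖∇f‖² + ∫ W |f|²)^{1/2}`. -/
def formSpace (W : Torus2 → ℝ) :
    Submodule ℂ (PiLp 2 fun _ : Fin 4 => Lp ℂ 2 (volume : Measure Torus2)) where
  carrier := {x | (∀ φ, ∀ hφ : IsTestFunction φ,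
      inner ℂ hφ.partial₁.conjLp (x 0) + inner ℂ hφ.conjLp (x 1) = 0) ∧
    (∀ φ, ∀ hφ : IsTestFunction φ,
      inner ℂ hφ.partial₂.conjLp (x 0) + inner ℂ hφ.conjLp (x 2) = 0) ∧
    x 3 =ᵐ[volume] fun p => (√(W p) : ℂ) * x 0 p}
  zero_mem' := by
    refine ⟨fun φ hφ => by simp, fun φ hφ => by simp, ?_⟩
    filter_upwards [Lp.coeFn_zero ℂ 2 (volume : Measure Torus2)] with p hp
    simp only [PiLp.zero_apply, hp]
    simp
  add_mem' := by
    rintro x y ⟨hx1, hx2, hx3⟩ ⟨hy1, hy2, hy3⟩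
    refine ⟨fun φ hφ => ?_, fun φ hφ => ?_, ?_⟩
    · simp only [PiLp.add_apply, inner_add_right]
      linear_combination hx1 φ hφ + hy1 φ hφ
    · simp only [PiLp.add_apply, inner_add_right]
      linear_combination hx2 φ hφ + hy2 φ hφ
    · filter_upwards [hx3, hy3, Lp.coeFn_add (x 0) (y 0), Lp.coeFn_add (x 3) (y 3)]
        with p h1 h2 h3 h4
      simp only [PiLp.add_apply, h3, h4, Pi.add_apply, h1, h2]
      ring
  smul_mem' := by
    rintro c x ⟨hx1, hx2, hx3⟩
    refine ⟨fun φ hφ => ?_, fun φ hφ => ?_, ?_⟩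
    · simp only [PiLp.smul_apply, inner_smul_right]
      linear_combination c * hx1 φ hφ
    · simp only [PiLp.smul_apply, inner_smul_right]
      linear_combination c * hx2 φ hφ
    · filter_upwards [hx3, Lp.coeFn_smul c (x 0), Lp.coeFn_smul c (x 3)] with p h1 h3 h4
      simp only [PiLp.smul_apply, h3, h4, Pi.smul_apply, h1, smul_eq_mul]
      ring

/-- Multiplication by a fixed function is a closed operator on `L²`. -/
lemma ae_eq_mul_of_tendsto {α : Type*} [MeasurableSpace α] {ν : Measure α} {m : α → ℂ}
    {F G : ℕ → Lp ℂ 2 ν} {F' G' : Lp ℂ 2 ν} (hF : Tendsto F atTop (𝓝 F'))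
    (hG : Tendsto G atTop (𝓝 G')) (h : ∀ n, G n =ᵐ[ν] fun p => m p * F n p) :
    G' =ᵐ[ν] fun p => m p * F' p := by
  obtain ⟨σ, hσ, h1⟩ := (tendstoInMeasure_of_tendsto_Lp hF).exists_seq_tendsto_ae
  obtain ⟨τ, hτ, h2⟩ :=
    (tendstoInMeasure_of_tendsto_Lp (hG.comp hσ.tendsto_atTop)).exists_seq_tendsto_ae
  filter_upwards [h1, h2, ae_all_iff.2 h] with p h1 h2 h3
  refine tendsto_nhds_unique h2 ?_
  simp only [Function.comp_apply, h3]
  exact (h1.comp hτ.tendsto_atTop).const_mul _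

lemma isClosed_formSpace (W : Torus2 → ℝ) :
    IsClosed (formSpace W : Set (PiLp 2 fun _ : Fin 4 => Lp ℂ 2 (volume : Measure Torus2))) := by
  refine isClosed_of_closure_subset fun x hx => ?_
  obtain ⟨y, hy, hlim⟩ := mem_closure_iff_seq_limit.1 hx
  have hc : ∀ i, Tendsto (fun n => y n i) atTop (𝓝 (x i)) := fun i =>
    ((PiLp.continuous_apply 2 _ i).tendsto x).comp hlim
  refine ⟨fun φ hφ => ?_, fun φ hφ => ?_, ae_eq_mul_of_tendsto (hc 0) (hc 3) fun n => (hy n).2.2⟩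
  · refine tendsto_nhds_unique ((tendsto_const_nhds.inner (hc 0)).add
      (tendsto_const_nhds.inner (hc 1))) ?_
    simp only [(hy _).1 φ hφ]
    exact tendsto_const_nhds
  · refine tendsto_nhds_unique ((tendsto_const_nhds.inner (hc 0)).add
      (tendsto_const_nhds.inner (hc 2))) ?_
    simp only [(hy _).2.1 φ hφ]
    exact tendsto_const_nhds

/-- The form domain as a Hilbert space; its topology is the one of the form norm. -/
def FormDomain (W : Torus2 → ℝ) : Type := formSpace W

instance (W : Torus2 → ℝ) : NormedAddCommGroup (FormDomain W) :=
  inferInstanceAs (NormedAddCommGroup (formSpace W))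

instance (W : Torus2 → ℝ) : InnerProductSpace ℂ (FormDomain W) :=
  inferInstanceAs (InnerProductSpace ℂ (formSpace W))

instance (W : Torus2 → ℝ) : CompleteSpace (FormDomain W) :=
  (isClosed_formSpace W).completeSpace_coe

lemma FormDomain.norm_sq_eq {W : Torus2 → ℝ} (x : FormDomain W) :
    ‖x‖ ^ 2 = ‖x.1 0‖ ^ 2 + ‖x.1 1‖ ^ 2 + ‖x.1 2‖ ^ 2 + ‖x.1 3‖ ^ 2 := by
  change ‖x.1‖ ^ 2 = _
  rw [PiLp.norm_sq_eq_of_L2, Fin.sum_univ_four]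

lemma norm_sqrt_mul_sq {w : ℝ} (hw : 0 ≤ w) (z : ℂ) : ‖(√w : ℂ) * z‖ ^ 2 = w * ‖z‖ ^ 2 := by
  rw [norm_mul, mul_pow, Complex.norm_real, Real.norm_eq_abs, sq_abs, Real.sq_sqrt hw]

lemma inFormDomain_of_mem_formSpace {W : Torus2 → ℝ} (hW0 : ∀ p, 0 ≤ W p)
    {x : PiLp 2 fun _ : Fin 4 => Lp ℂ 2 (volume : Measure Torus2)} (hx : x ∈ formSpace W) :
    InFormDomain W (x 0) (x 1) (x 2) := by
  refine ⟨⟨Lp.memLp _, Lp.memLp _, Lp.memLp _, fun φ hφ => ?_, fun φ hφ => ?_⟩, ?_⟩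
  · rw [← hφ.partial₁.inner_conjLp, ← hφ.inner_conjLp]
    exact eq_neg_of_add_eq_zero_left (hx.1 φ hφ)
  · rw [← hφ.partial₂.inner_conjLp, ← hφ.inner_conjLp]
    exact eq_neg_of_add_eq_zero_left (hx.2.1 φ hφ)
  · refine (Lp.memLp (x 3)).integrable_norm_pow (by simp) |>.congr ?_
    filter_upwards [hx.2.2] with p hp
    rw [hp]
    exact norm_sqrt_mul_sq (hW0 p) _

lemma InFormDomain.memLp_sqrt_mul {W : Torus2 → ℝ} (hW : Measurable W) (hW0 : ∀ p, 0 ≤ W p)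
    {f f₁ f₂ : Torus2 → ℂ} (hf : InFormDomain W f f₁ f₂) :
    MemLp (fun p => (√(W p) : ℂ) * f p) 2 volume := by
  have hm : AEStronglyMeasurable (fun p => (√(W p) : ℂ) * f p) volume :=
    (Complex.measurable_ofReal.comp hW.sqrt).aestronglyMeasurable.mul
      hf.1.memLp.aestronglyMeasurable
  rw [memLp_two_iff_integrable_sq_norm hm]
  simpa only [norm_sqrt_mul_sq (hW0 _)] using hf.2

lemma InFormDomain.exists_mem_formSpace {W : Torus2 → ℝ} (hW : Measurable W)
    (hW0 : ∀ p, 0 ≤ W p) {f f₁ f₂ : Torus2 → ℂ} (hf : InFormDomain W f f₁ f₂) :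
    ∃ x ∈ formSpace W, x 0 =ᵐ[volume] f ∧ x 1 =ᵐ[volume] f₁ ∧ x 2 =ᵐ[volume] f₂ := by
  have hs := hf.memLp_sqrt_mul hW hW0
  refine ⟨WithLp.toLp 2 ![hf.1.memLp.toLp f, hf.1.memLp₁.toLp f₁, hf.1.memLp₂.toLp f₂,
    hs.toLp _], ⟨fun φ hφ => ?_, fun φ hφ => ?_, ?_⟩, hf.1.memLp.coeFn_toLp,
    hf.1.memLp₁.coeFn_toLp, hf.1.memLp₂.coeFn_toLp⟩
  · rw [hφ.partial₁.inner_conjLp, hφ.inner_conjLp, add_eq_zero_iff_eq_neg]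
    convert! hf.1.weak₁ φ hφ using 1
    · refine integral_congr_ae ?_
      filter_upwards [hf.1.memLp.coeFn_toLp] with p hp
      simp [hp]
    · congr 1
      refine integral_congr_ae ?_
      filter_upwards [hf.1.memLp₁.coeFn_toLp] with p hp
      simp [hp]
  · rw [hφ.partial₂.inner_conjLp, hφ.inner_conjLp, add_eq_zero_iff_eq_neg]
    convert! hf.1.weak₂ φ hφ using 1
    · refine integral_congr_ae ?_
      filter_upwards [hf.1.memLp.coeFn_toLp] with p hp
      simp [hp]
    · congr 1
      refine integral_congr_ae ?_
      filter_upwards [hf.1.memLp₂.coeFn_toLp] with p hp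
      simp [hp]
  · filter_upwards [hf.1.memLp.coeFn_toLp, hs.coeFn_toLp] with p h1 h2
    simp [h1, h2]

lemma inner_formSpace {W : Torus2 → ℝ} (hW0 : ∀ p, 0 ≤ W p)
    {x y : PiLp 2 fun _ : Fin 4 => Lp ℂ 2 (volume : Measure Torus2)} (hx : x ∈ formSpace W)
    (hy : y ∈ formSpace W) :
    inner ℂ y x = inner ℂ (y 0) (x 0) + ∫ p, (x 1 p * conj (y 1 p) + x 2 p * conj (y 2 p) +
      (W p : ℂ) * x 0 p * conj (y 0 p)) := by
  have hi : ∀ i, Integrable (fun p => x i p * conj (y i p)) volume := fun i =>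
    (L2.integrable_inner (𝕜 := ℂ) (y i) (x i)).congr
      (Eventually.of_forall fun p => by simp)
  have he : ∀ i, inner ℂ (y i) (x i) = ∫ p, x i p * conj (y i p) := fun i => by
    rw [L2.inner_def]
    simp
  have h3 : (fun p => x 3 p * conj (y 3 p)) =ᵐ[volume]
      fun p => (W p : ℂ) * x 0 p * conj (y 0 p) := by
    filter_upwards [hx.2.2, hy.2.2] with p h1 h2
    rw [h1, h2, map_mul, Complex.conj_ofReal]
    have : (W p : ℂ) = (√(W p) : ℂ) * (√(W p) : ℂ) := by
      rw [← Complex.ofReal_mul, Real.mul_self_sqrt (hW0 p)]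
    rw [this]
    ring
  rw [PiLp.inner_apply, Fin.sum_univ_four, he 1, he 2, he 3, integral_congr_ae h3,
    integral_add (f := fun p => x 1 p * conj (y 1 p) + x 2 p * conj (y 2 p))
      ((hi 1).add (hi 2)) ((hi 3).congr h3), integral_add (hi 1) (hi 2)]
  ring

/-- The inclusion of the form domain into `L²(𝕋²)`. -/
def formInclusion (W : Torus2 → ℝ) : FormDomain W →L[ℂ] Lp ℂ 2 (volume : Measure Torus2) :=
  LinearMap.mkContinuous
    { toFun := fun x => x.1 0
      map_add' := fun _ _ => rfl
      map_smul' := fun _ _ => rfl } 1 fun x => by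
    rw [one_mul]
    exact PiLp.norm_apply_le x.1 0

lemma formInclusion_apply {W : Torus2 → ℝ} (x : FormDomain W) :
    formInclusion W x = x.1 0 := rfl

/-- The orthogonal projection of `L²(𝕋²)` onto the trigonometric polynomials of degree at most `N`
in each variable. -/
def trigProjection (N : ℕ) :
    Lp ℂ 2 (volume : Measure Torus2) →L[ℂ] Lp ℂ 2 (volume : Measure Torus2) :=
  ∑ k ∈ Finset.Icc (-(N : ℤ)) N ×ˢ Finset.Icc (-(N : ℤ)) N,
    (innerSL ℂ (characterBasis k)).smulRight (characterBasis k)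

lemma inner_trigProjection (N : ℕ) (k : ℤ × ℤ) (F : Lp ℂ 2 (volume : Measure Torus2)) :
    inner ℂ (characterBasis k) (trigProjection N F) =
      if k ∈ Finset.Icc (-(N : ℤ)) N ×ˢ Finset.Icc (-(N : ℤ)) N
        then inner ℂ (characterBasis k) F else 0 := by
  rw [trigProjection, sum_apply, inner_sum]
  simp only [ContinuousLinearMap.smulRight_apply, innerSL_apply_apply, inner_smul_right,
    orthonormal_iff_ite.1 characterBasis.orthonormal, mul_ite, mul_one, mul_zero]
  rw [Finset.sum_ite_eq]

lemma isCompactOperator_trigProjection (N : ℕ) : IsCompactOperator (trigProjection N) := by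
  refine Submodule.sum_mem (compactOperator (RingHom.id ℂ) (Lp ℂ 2 (volume : Measure Torus2))
    (Lp ℂ 2 (volume : Measure Torus2))) (fun k _ => ?_)
  exact (isCompactOperator_of_locallyCompactSpace_rng
    (ContinuousLinearMap.toSpanSingleton ℂ (characterBasis k))).comp_clm
      (innerSL ℂ (characterBasis k))

lemma norm_sub_trigProjection_sq_le {f f₁ f₂ : Lp ℂ 2 (volume : Measure Torus2)}
    (h : HasWeakGradient f f₁ f₂) (N : ℕ) :
    ((N : ℝ) + 1) ^ 2 * ‖f - trigProjection N f‖ ^ 2 ≤ ‖f₁‖ ^ 2 + ‖f₂‖ ^ 2 := by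
  refine hasSum_le (fun k => ?_) ((hasSum_characterBasis _).mul_left _)
    ((hasSum_characterBasis f₁).add (hasSum_characterBasis f₂))
  have h1 := h.inner_characterBasis₁ k
  have h2 := h.inner_characterBasis₂ k
  rw [Lp.toLp_coeFn, Lp.toLp_coeFn] at h1 h2
  rw [inner_sub_right, inner_trigProjection, h1, h2]
  split_ifs with hk
  · rw [sub_self, norm_zero, zero_pow two_ne_zero, mul_zero]
    positivity
  · simp only [norm_mul, mul_pow, Complex.norm_I, one_mul, sub_zero, ← add_mul]
    gcongr
    rw [Finset.mem_product, Finset.mem_Icc, Finset.mem_Icc, not_and_or] at hk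
    simp only [Complex.norm_intCast, sq_abs]
    have hint : ((N : ℤ) + 1) ^ 2 ≤ k.1 ^ 2 + k.2 ^ 2 := by
      rcases hk with hk | hk
      · have : (N : ℤ) + 1 ≤ |k.1| := by
          by_contra hcon
          exact hk (abs_le.1 (by lia))
        nlinarith [sq_abs k.1, sq_nonneg k.2]
      · have : (N : ℤ) + 1 ≤ |k.2| := by
          by_contra hcon
          exact hk (abs_le.1 (by lia))
        nlinarith [sq_abs k.2, sq_nonneg k.1]
    exact_mod_cast hint

/-- Rellich's theorem for the form domain. -/
lemma isCompactOperator_formInclusion {W : Torus2 → ℝ} (hW0 : ∀ p, 0 ≤ W p) :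
    IsCompactOperator (formInclusion W) := by
  refine isCompactOperator_of_tendsto (l := atTop)
    (F := fun N : ℕ => (trigProjection N).comp (formInclusion W)) ?_
    (Eventually.of_forall fun N =>
      (isCompactOperator_trigProjection N).comp_clm (formInclusion W))
  rw [tendsto_iff_norm_sub_tendsto_zero]
  refine squeeze_zero (fun _ => norm_nonneg _) (fun N => ?_)
    (tendsto_one_div_add_atTop_nhds_zero_nat (𝕜 := ℝ))
  refine ContinuousLinearMap.opNorm_le_bound _ (by positivity) fun x => ?_
  have h := norm_sub_trigProjection_sq_le (inFormDomain_of_mem_formSpace hW0 x.2).1 N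
  have hN : (0 : ℝ) < N + 1 := by positivity
  rw [sub_apply, ContinuousLinearMap.comp_apply, norm_sub_rev,
    formInclusion_apply, div_mul_eq_mul_div, one_mul, le_div_iff₀ hN, mul_comm]
  refine le_of_sq_le_sq ?_ (norm_nonneg _)
  rw [mul_pow, x.norm_sq_eq]
  nlinarith [sq_nonneg ‖x.1 0‖, sq_nonneg ‖x.1 3‖]

/-! ### The smallest eigenvalue -/

/-- Testing the eigenvalue equation against the eigenfunction. -/
lemma IsSchrodingerEigenvalue.exists_energy_eq {W : Torus2 → ℝ} {ν : ℝ}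
    (h : IsSchrodingerEigenvalue W ν) :
    ∃ f f₁ f₂ : Torus2 → ℂ, ¬ (f =ᵐ[volume] 0) ∧ InFormDomain W f f₁ f₂ ∧
      (∫ p, ‖f₁ p‖ ^ 2) + (∫ p, ‖f₂ p‖ ^ 2) + (∫ p, W p * ‖f p‖ ^ 2) = ν * ∫ p, ‖f p‖ ^ 2 := by
  obtain ⟨f, hf0, -, f₁, f₂, hf, heq⟩ := h
  refine ⟨f, f₁, f₂, hf0, hf, ?_⟩
  have h := heq f f₁ f₂ hf
  have e1 : ∀ p, f₁ p * conj (f₁ p) + f₂ p * conj (f₂ p) + (W p : ℂ) * f p * conj (f p) =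
      ((‖f₁ p‖ ^ 2 + ‖f₂ p‖ ^ 2 + W p * ‖f p‖ ^ 2 : ℝ) : ℂ) := fun p => by
    push_cast
    rw [Complex.mul_conj', Complex.mul_conj', mul_assoc, Complex.mul_conj']
  have e2 : ∀ p, (ν : ℂ) * f p * conj (f p) = ((ν * ‖f p‖ ^ 2 : ℝ) : ℂ) := fun p => by
    push_cast
    rw [mul_assoc, Complex.mul_conj']
  simp only [e1, e2, integral_complex_ofReal] at h
  have h' := Complex.ofReal_injective h
  have i1 := hf.1.memLp₁.integrable_norm_pow (by simp)
  have i2 := hf.1.memLp₂.integrable_norm_pow (by simp)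
  rwa [integral_add (f := fun p => ‖f₁ p‖ ^ 2 + ‖f₂ p‖ ^ 2) (i1.add i2) hf.2,
    integral_add i1 i2, integral_const_mul] at h'

lemma integral_norm_sq_pos {f : Torus2 → ℂ} (hf : MemLp f 2 volume) (hf0 : ¬ (f =ᵐ[volume] 0)) :
    0 < ∫ p, ‖f p‖ ^ 2 := by
  rw [← norm_toLp_sq hf]
  refine pow_pos (norm_pos_iff.2 fun h => hf0 ?_) 2
  exact hf.coeFn_toLp.symm.trans (by rw [h]; exact Lp.coeFn_zero _ _ _)

/-- The form sum `-Δ + W` on `𝕋²` has a smallest eigenvalue as soon as its form domain is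
nonzero. -/
theorem exists_isLeast_isSchrodingerEigenvalue {W : Torus2 → ℝ} (hW : Measurable W)
    (hW0 : ∀ p, 0 ≤ W p)
    (hne : ∃ f f₁ f₂ : Torus2 → ℂ, InFormDomain W f f₁ f₂ ∧ ¬ (f =ᵐ[volume] 0)) :
    ∃ μ, IsLeast {ν : ℝ | IsSchrodingerEigenvalue W ν} μ := by
  set J := formInclusion W with hJ
  have hJ0 : J ≠ 0 := by
    obtain ⟨f, f₁, f₂, hf, hf0⟩ := hne
    obtain ⟨x, hx, hx0, -, -⟩ := hf.exists_mem_formSpace hW hW0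
    intro h
    apply hf0
    have : x 0 = 0 :=
       congrArg (fun T : FormDomain W →L[ℂ] _ => T ⟨x, hx⟩) h
    exact hx0.symm.trans (by rw [this]; exact Lp.coeFn_zero _ _ _)
  have hpos : 0 < ‖J‖ := norm_pos_iff.2 hJ0
  refine ⟨(‖J‖ ^ 2)⁻¹ - 1, ?_, ?_⟩
  · -- `⟨J g, J x⟩ = ‖J‖² ⟨g, x⟩` says that the energy pairing of `x` and `g` is
    -- `(‖J‖⁻² - 1) ⟨J g, J x⟩`
    obtain ⟨x, hx0, hx⟩ :=
      exists_inner_eq_of_isCompactOperator (isCompactOperator_formInclusion hW0) hJ0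
    refine ⟨x.1 0, fun h => hx0 ?_, (Lp.memLp _).const_mul _, x.1 1, x.1 2,
      inFormDomain_of_mem_formSpace hW0 x.2, fun g g₁ g₂ hg => ?_⟩
    · exact Lp.ext (h.trans (Lp.coeFn_zero _ _ _).symm)
    obtain ⟨y, hy, hy0, hy1, hy2⟩ := hg.exists_mem_formSpace hW hW0
    have h1 : inner ℂ (y 0) (x.1 0) = (‖J‖ : ℂ) ^ 2 * inner ℂ y x.1 := hx ⟨y, hy⟩
    have h2 := inner_formSpace hW0 x.2 hy
    rw [h2] at h1
    have e0 : inner ℂ (y 0) (x.1 0) = ∫ p, x.1 0 p * conj (g p) := by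
      rw [L2.inner_def]
      refine integral_congr_ae ?_
      filter_upwards [hy0] with p hp
      simp [hp]
    have e1 : ∫ p, (x.1 1 p * conj (y 1 p) + x.1 2 p * conj (y 2 p) +
        (W p : ℂ) * x.1 0 p * conj (y 0 p)) = ∫ p, (x.1 1 p * conj (g₁ p) +
        x.1 2 p * conj (g₂ p) + (W p : ℂ) * x.1 0 p * conj (g p)) := by
      refine integral_congr_ae ?_
      filter_upwards [hy0, hy1, hy2] with p h0 h1 h2
      rw [h0, h1, h2]
    rw [e1] at h1
    simp only at h1
    rw [e0] at h1
    simp only [mul_assoc (((_ : ℝ) : ℂ))]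
    rw [integral_const_mul]
    have hc : (‖J‖ : ℂ) ≠ 0 := by exact_mod_cast hpos.ne'
    push_cast
    field_simp
    linear_combination -h1
  · -- an eigenfunction has squared form norm `(1 + ν) ‖f‖²`, to be compared with `‖J‖`
    intro ν hν
    obtain ⟨f, f₁, f₂, hf0, hf, henergy⟩ := IsSchrodingerEigenvalue.exists_energy_eq hν
    obtain ⟨x, hx, hx0, hx1, hx2⟩ := hf.exists_mem_formSpace hW hW0
    have hfpos := integral_norm_sq_pos hf.1.memLp hf0
    have n0 : ‖x 0‖ ^ 2 = ∫ p, ‖f p‖ ^ 2 := by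
      rw [← norm_toLp_sq hf.1.memLp, ← Lp.toLp_coeFn (x 0) (Lp.memLp _),
        (MemLp.toLp_eq_toLp_iff _ _).2 hx0]
    have n1 : ‖x 1‖ ^ 2 = ∫ p, ‖f₁ p‖ ^ 2 := by
      rw [← norm_toLp_sq hf.1.memLp₁, ← Lp.toLp_coeFn (x 1) (Lp.memLp _),
        (MemLp.toLp_eq_toLp_iff _ _).2 hx1]
    have n2 : ‖x 2‖ ^ 2 = ∫ p, ‖f₂ p‖ ^ 2 := by
      rw [← norm_toLp_sq hf.1.memLp₂, ← Lp.toLp_coeFn (x 2) (Lp.memLp _),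
        (MemLp.toLp_eq_toLp_iff _ _).2 hx2]
    have n3 : ‖x 3‖ ^ 2 = ∫ p, W p * ‖f p‖ ^ 2 := by
      rw [← Lp.toLp_coeFn (x 3) (Lp.memLp _), norm_toLp_sq]
      refine integral_congr_ae ?_
      filter_upwards [hx.2.2, hx0] with p h1 h2
      rw [h1, h2, norm_sqrt_mul_sq (hW0 p)]
    have hnx : ‖x‖ ^ 2 = (1 + ν) * ‖x 0‖ ^ 2 := by
      rw [PiLp.norm_sq_eq_of_L2, Fin.sum_univ_four, n1, n2, n3, n0]
      linarith
    have hle : ‖x 0‖ ≤ ‖J‖ * ‖x‖ := J.le_opNorm ⟨x, hx⟩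
    have hle2 : ‖x 0‖ ^ 2 ≤ (‖J‖ ^ 2 * (1 + ν)) * ‖x 0‖ ^ 2 := by
      calc ‖x 0‖ ^ 2 ≤ (‖J‖ * ‖x‖) ^ 2 := by gcongr
        _ = _ := by rw [mul_pow, hnx, mul_assoc]
    have h1 : 1 ≤ ‖J‖ ^ 2 * (1 + ν) := by
      rw [n0] at hle2
      exact (le_mul_iff_one_le_left hfpos).1 hle2
    have h2 : (‖J‖ ^ 2)⁻¹ ≤ 1 + ν := by
      rwa [inv_le_iff_one_le_mul₀ (by positivity), mul_comm]
    linarith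

/-! ### The shear potential -/

lemma SmoothOnTorus.continuous {f : Torus → ℝ} (hf : SmoothOnTorus f) : Continuous f :=
  (QuotientAddGroup.isOpenQuotientMap_mk (N := AddSubgroup.zmultiples (2 * Real.pi))
    ).continuous_comp_iff.1 (ContDiff.continuous hf)

lemma shearPotential_nonneg {ι : Type*} (u : ι → Torus → ℝ) (p : Torus2) :
    0 ≤ shearPotential u p :=
  tsum_nonneg fun _ => sq_nonneg _

lemma isClosed_shearPotential_le {ι : Type*} {u : ι → Torus → ℝ} (hu : ∀ j, Continuous (u j))
    (hV : ∀ x y : Torus, Summable fun j => (u j y - u j x) ^ 2) (M : ℝ) :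
    IsClosed {p | shearPotential u p ≤ M} := by
  have h : {p | shearPotential u p ≤ M} =
      ⋂ s : Finset ι, {p | ∑ j ∈ s, (u j p.2 - u j p.1) ^ 2 ≤ M} := by
    ext p
    simp only [Set.mem_ofPred_eq, Set.mem_iInter]
    exact ⟨fun h s => ((hV p.1 p.2).sum_le_tsum s fun _ _ => sq_nonneg _).trans h,
      fun h => (hV p.1 p.2).tsum_le_of_sum_le h⟩
  rw [h]
  exact isClosed_iInter fun s => isClosed_le
    (continuous_finsetSum _ fun j _ =>
      (((hu j).comp continuous_snd).sub ((hu j).comp continuous_fst)).pow 2) continuous_const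

lemma measurable_shearPotential {ι : Type*} {u : ι → Torus → ℝ} (hu : ∀ j, Continuous (u j))
    (hV : ∀ x y : Torus, Summable fun j => (u j y - u j x) ^ 2) :
    Measurable (shearPotential u) :=
  measurable_of_Iic fun M => (isClosed_shearPotential_le hu hV M).measurableSet

/-- A finite lower semicontinuous potential is bounded on some nonempty open set, by Baire's
theorem. -/
lemma exists_isOpen_shearPotential_le {ι : Type*} {u : ι → Torus → ℝ}
    (hu : ∀ j, Continuous (u j))
    (hV : ∀ x y : Torus, Summable fun j => (u j y - u j x) ^ 2) :
    ∃ M : ℝ, ∃ O : Set Torus2, IsOpen O ∧ O.Nonempty ∧ ∀ p ∈ O, shearPotential u p ≤ M := by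
  obtain ⟨n, hn⟩ := nonempty_interior_of_iUnion_of_closed
    (f := fun n : ℕ => {p : Torus2 | shearPotential u p ≤ n})
    (fun n => isClosed_shearPotential_le hu hV n) (by
      rw [Set.iUnion_eq_univ_iff]
      exact fun p => exists_nat_ge (shearPotential u p))
  refine ⟨n, _, isOpen_interior, hn, fun p hp => ?_⟩
  have h : p ∈ {p | shearPotential u p ≤ n} := interior_subset hp
  exact h

/-! ### The form domain is nonzero -/

lemma re_fourier_one_le (x : Torus) : (fourier 1 x : ℂ).re ≤ 1 := by
  rw [fourier_one]
  exact (Complex.re_le_norm _).trans (Circle.norm_coe _).le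

lemma re_fourier_one_eq_one_iff {x : Torus} : (fourier 1 x : ℂ).re = 1 ↔ x = 0 := by
  refine ⟨fun h => ?_, fun h => by simp [h]⟩
  have hn : ‖(fourier 1 x : ℂ)‖ = 1 := by
    rw [fourier_one]
    exact Circle.norm_coe _
  have h1 : (fourier 1 x : ℂ) = 1 := by
    have him : (fourier 1 x : ℂ).im ^ 2 = 0 := by
      have := Complex.sq_norm (fourier 1 x : ℂ)
      rw [hn, Complex.normSq_apply, h] at this
      nlinarith
    exact Complex.ext h (by simpa using him)
  rw [fourier_one] at h1
  refine AddCircle.injective_toCircle (T := 2 * Real.pi) Real.two_pi_pos.ne' (Circle.ext ?_)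
  simpa using h1

/-- Every nonempty open set supports a nonzero test function, built from the trigonometric
polynomial `cos (x - a) + cos (y - b) - 2`, which vanishes at `(a, b)` and is negative elsewhere. -/
lemma exists_isTestFunction_of_isOpen {O : Set Torus2} (hO : IsOpen O) (hne : O.Nonempty) :
    ∃ φ, IsTestFunction φ ∧ (∀ p ∉ O, φ p = 0) ∧ ∃ p, φ p ≠ 0 := by
  obtain ⟨p₀, hp₀⟩ := hne
  set Ψ : Torus2 → ℝ := fun p =>
    (fourier 1 (p.1 - p₀.1) : ℂ).re + (fourier 1 (p.2 - p₀.2) : ℂ).re - 2 with hΨ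
  have hΨc : Continuous Ψ := by fun_prop
  have hneg : ∀ p ∉ O, Ψ p < 0 := by
    intro p hp
    have h1 := re_fourier_one_le (p.1 - p₀.1)
    have h2 := re_fourier_one_le (p.2 - p₀.2)
    refine lt_of_le_of_ne (by simp only [hΨ]; linarith) fun h => hp ?_
    simp only [hΨ] at h
    have e1 := re_fourier_one_eq_one_iff.1 (show (fourier 1 (p.1 - p₀.1) : ℂ).re = 1 by linarith)
    have e2 := re_fourier_one_eq_one_iff.1 (show (fourier 1 (p.2 - p₀.2) : ℂ).re = 1 by linarith)
    rwa [show p = p₀ from Prod.ext (sub_eq_zero.1 e1) (sub_eq_zero.1 e2)]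
  obtain ⟨ε, hε, hle⟩ : ∃ ε > 0, ∀ p ∉ O, Ψ p ≤ -ε := by
    rcases Set.eq_empty_or_nonempty Oᶜ with h | h
    · exact ⟨1, one_pos, fun p hp => by simpa [h] using (show p ∈ Oᶜ from hp)⟩
    · obtain ⟨q, hq, hmax⟩ := hO.isClosed_compl.isCompact.exists_isMaxOn h hΨc.continuousOn
      exact ⟨-Ψ q, neg_pos.2 (hneg q hq), fun p hp => by simpa using hmax hp⟩
  refine ⟨fun p => (expNegInvGlue (Ψ p + ε) : ℂ), ?_, fun p hp => ?_, p₀, ?_⟩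
  · obtain ⟨⟨a, b⟩, rfl⟩ := exists_coe_torus2 p₀
    have hs : ∀ a : ℝ, ContDiff ℝ ∞ fun t : ℝ => (fourier 1 ((t : Torus) - (a : Torus)) : ℂ).re :=
      fun a => Complex.reCLM.contDiff.comp
        ((contDiff_fourier_torus 1).comp (contDiff_id.sub contDiff_const))
    have hΨs : ContDiff ℝ ∞ fun q : ℝ × ℝ => Ψ ((q.1 : Torus), (q.2 : Torus)) :=
      (((hs a).comp contDiff_fst).add ((hs b).comp contDiff_snd)).sub contDiff_const
    exact Complex.ofRealCLM.contDiff.comp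
      (expNegInvGlue.contDiff.comp (hΨs.add contDiff_const))
  · have := hle p hp
    beta_reduce
    rw [expNegInvGlue.zero_of_nonpos (by linarith), Complex.ofReal_zero]
  · have : Ψ p₀ = 0 := by
      simp only [hΨ, sub_self, fourier_eval_zero, Complex.one_re]
      norm_num
    beta_reduce
    rw [this, zero_add]
    exact_mod_cast (expNegInvGlue.pos_of_pos hε).ne'

lemma exists_inFormDomain_ne_zero {W : Torus2 → ℝ} (hW : Measurable W) (hW0 : ∀ p, 0 ≤ W p)
    {M : ℝ} {O : Set Torus2} (hO : IsOpen O) (hne : O.Nonempty) (hM : ∀ p ∈ O, W p ≤ M) :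
    ∃ f f₁ f₂ : Torus2 → ℂ, InFormDomain W f f₁ f₂ ∧ ¬ (f =ᵐ[volume] 0) := by
  obtain ⟨φ, hφ, hφO, p, hp⟩ := exists_isTestFunction_of_isOpen hO hne
  refine ⟨φ, _, _, ⟨hφ.hasWeakGradient, ?_⟩, fun h => hp ?_⟩
  · have hi := (hφ.memLp.integrable_norm_pow (by simp)).const_mul M
    refine hi.mono' (hW.aestronglyMeasurable.mul
      (hφ.continuous.norm.pow 2).aestronglyMeasurable) (Eventually.of_forall fun p => ?_)
    rw [Real.norm_of_nonneg (mul_nonneg (hW0 p) (sq_nonneg _))]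
    by_cases hpO : p ∈ O
    · exact mul_le_mul_of_nonneg_right (hM p hpO) (sq_nonneg _)
    · simp [hφO p hpO]
  · exact congrFun ((hφ.continuous.ae_eq_iff_eq volume continuous_zero).1 h) p

/-! ### Finite differences -/

/-- If the `m`-th derivative of `w` is at least `δ`, then among `m + 1` equidistant points with
step `h` there is one at which `|w|` is at least `δ (h / 2) ^ m`: the `m`-th difference of `w` is at
least `δ h ^ m`. -/
lemma exists_le_abs_of_le_iteratedDeriv (m : ℕ) {w : ℝ → ℝ} (hw : ContDiff ℝ ∞ w) {a h δ : ℝ}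
    (hh : 0 < h) (H : ∀ t ∈ Set.Icc a (a + m * h), δ ≤ iteratedDeriv m w t) :
    ∃ k ≤ m, δ * (h / 2) ^ m ≤ |w (a + k * h)| := by
  induction m generalizing w δ with
  | zero =>
    refine ⟨0, le_rfl, ?_⟩
    have := H a (by simp)
    rw [iteratedDeriv_zero] at this
    simpa using this.trans (le_abs_self _)
  | succ m ih =>
    have hw' : ContDiff ℝ ∞ fun t => w (t + h) := hw.comp (contDiff_id.add contDiff_const)
    obtain ⟨k, hk, hle⟩ := ih (w := fun t => w (t + h) - w t) (δ := δ * h) (hw'.sub hw) (by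
      intro t ht
      have hm : ContDiffAt ℝ m w t := (hw.of_le (by exact_mod_cast le_top)).contDiffAt
      have hm' : ContDiffAt ℝ m (fun t => w (t + h)) t :=
        (hw'.of_le (by exact_mod_cast le_top)).contDiffAt
      rw [iteratedDeriv_fun_sub hm' hm, iteratedDeriv_comp_add_const]
      have hd : Differentiable ℝ (iteratedDeriv m w) :=
        hw.differentiable_iteratedDeriv m (by exact_mod_cast WithTop.coe_lt_top _)
      have := (convex_Icc t (t + h)).mul_sub_le_image_sub_of_le_deriv
        hd.continuous.continuousOn hd.differentiableOn (C := δ) (fun s hs => ?_) t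
        (by constructor <;> linarith) (t + h) (by constructor <;> linarith) (by linarith)
      · simpa using this
      · rw [← iteratedDeriv_succ]
        have hs' := interior_subset hs
        refine H s ⟨ht.1.trans hs'.1, ?_⟩
        push_cast
        linarith [hs'.2, ht.2])
    have e : δ * (h / 2) ^ (m + 1) = δ * h * (h / 2) ^ m / 2 := by ring
    have habs := hle.trans (abs_sub _ _)
    by_cases hc : δ * (h / 2) ^ (m + 1) ≤ |w (a + k * h)|
    · exact ⟨k, hk.trans (Nat.le_succ m), hc⟩
    · refine ⟨k + 1, Nat.succ_le_succ hk, ?_⟩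
      have : a + ((k + 1 : ℕ) : ℝ) * h = a + k * h + h := by
        push_cast
        ring
      rw [this]
      linarith

lemma torusDeriv_coe (n : ℕ) (f : Torus → ℝ) (a : ℝ) :
    torusDeriv n f (a : Torus) = iteratedDeriv n (fun t : ℝ => f (t : Torus)) a := by
  have h := congrFun (iteratedDeriv_comp_const_add n (fun t : ℝ => f (t : Torus)) a) 0
  simpa [torusDeriv] using h

/-- Near a point where the `m`-th derivative of `v` does not vanish, `v` deviates from any
prescribed value `s` by a multiple of `h ^ m` at one of `m + 1` equidistant points. -/
lemma eventually_exists_le_sq_sub {v : Torus → ℝ} (hv : SmoothOnTorus v) {x : Torus} {m : ℕ}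
    (hm : m ≠ 0) (hx : torusDeriv m v x ≠ 0) :
    ∃ c > 0, ∃ h₀ > 0, ∀ᶠ y in 𝓝 x, ∀ h : ℝ, 0 < h → h ≤ h₀ → ∀ s : ℝ,
      ∃ k ≤ m, c * h ^ (2 * m) ≤ (v (y + ((k * h : ℝ) : Torus)) - s) ^ 2 := by
  obtain ⟨a, rfl⟩ := QuotientAddGroup.mk_surjective x
  change torusDeriv m v (a : Torus) ≠ 0 at hx
  rw [torusDeriv_coe] at hx
  set w : ℝ → ℝ := fun t => v (t : Torus) with hw
  have hws : ContDiff ℝ ∞ w := hv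
  set D := iteratedDeriv m w with hD
  have hDc : Continuous D := hws.continuous_iteratedDeriv m (by exact_mod_cast le_top)
  -- the sign of the derivative at `a`
  obtain ⟨σ, hσ1, hσ⟩ : ∃ σ : ℝ, |σ| = 1 ∧ 0 < σ * D a := by
    rcases lt_or_gt_of_ne hx with h | h
    · exact ⟨-1, by simp, by simpa using h⟩
    · exact ⟨1, by simp, by simpa using h⟩
  set δ := σ * D a / 2 with hδ
  have hδpos : 0 < δ := half_pos hσ
  have hnear : ∀ᶠ t in 𝓝 a, δ < σ * D t :=
    ((continuous_const.mul hDc).tendsto a).eventually_const_lt (half_lt_self hσ)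
  obtain ⟨r, hr, hball⟩ := Metric.eventually_nhds_iff.1 hnear
  have hm0 : (0 : ℝ) < m := by exact_mod_cast Nat.pos_of_ne_zero hm
  refine ⟨(δ / 2 ^ m) ^ 2, by positivity, r / 2 / m, by positivity, ?_⟩
  have hmap : 𝓝 ((a : ℝ) : Torus) = map ((↑) : ℝ → Torus) (𝓝 a) :=
    QuotientAddGroup.nhds_eq _ a
  change ∀ᶠ y in 𝓝 (a : Torus), _
  rw [hmap, eventually_map]
  filter_upwards [Metric.ball_mem_nhds a (half_pos hr)] with b hb h hh hh₀ s
  rw [Metric.mem_ball, Real.dist_eq, abs_lt] at hb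
  have hmh : m * h ≤ r / 2 := by
    rw [le_div_iff₀ hm0] at hh₀
    linarith
  obtain ⟨k, hk, hle⟩ := exists_le_abs_of_le_iteratedDeriv m (w := fun t => σ * (w t - s))
    (contDiff_const.mul (hws.sub contDiff_const)) (a := b) (δ := δ) hh (fun t ht => by
      have hit : iteratedDeriv m (fun t => σ * (w t - s)) t = σ * D t := by
        have h1 : (fun t => w t - s) = fun t => -s + w t := by
          ext t
          ring
        rw [iteratedDeriv_const_mul_field, h1, iteratedDeriv_const_add (Nat.pos_of_ne_zero hm)]
      rw [hit]
      refine (hball ?_).le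
      rw [Real.dist_eq, abs_lt]
      constructor <;> linarith [ht.1, ht.2])
  refine ⟨k, hk, ?_⟩
  rw [abs_mul, hσ1, one_mul] at hle
  have e : (δ / 2 ^ m) ^ 2 * h ^ (2 * m) = (δ * (h / 2) ^ m) ^ 2 := by
    rw [div_pow h, pow_mul']
    ring
  rw [e, ← sq_abs (v _ - s)]
  have : w (b + k * h) = v ((b : Torus) + ((k * h : ℝ) : Torus)) := by simp [hw]
  rw [this] at hle
  gcongr

/-- Among the points `y, y + h, …, y + (n₀ + 1) h` there is one at which the potential is at least a
multiple of `h ^ (2 (n₀ + 1))`, uniformly in `x` and `y`. -/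
lemma exists_le_shearPotential_translate {ι : Type*} {u : ι → Torus → ℝ}
    (hu : ∀ j, SmoothOnTorus (u j))
    (hV : ∀ x y : Torus, Summable fun j => (u j y - u j x) ^ 2) {n₀ : ℕ}
    (hn₀ : ∀ x : Torus, ∃ j, ∃ n ≤ n₀, torusDeriv (n + 1) (u j) x ≠ 0) :
    ∃ c > 0, ∃ h₀ > 0, ∀ h : ℝ, 0 < h → h ≤ h₀ → ∀ p : Torus2, ∃ k ≤ n₀ + 1,
      c * h ^ (2 * (n₀ + 1)) ≤ shearPotential u (p.1, p.2 + ((k * h : ℝ) : Torus)) := by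
  have key : ∃ c > 0, ∃ h₀ > 0, ∀ y ∈ (Set.univ : Set Torus), ∀ h : ℝ, 0 < h → h ≤ h₀ →
      ∀ z : Torus, ∃ k ≤ n₀ + 1,
        c * h ^ (2 * (n₀ + 1)) ≤ shearPotential u (z, y + ((k * h : ℝ) : Torus)) := by
    refine isCompact_univ.induction_on (p := fun A : Set Torus => ∃ c > 0, ∃ h₀ > 0, ∀ y ∈ A,
      ∀ h : ℝ, 0 < h → h ≤ h₀ → ∀ z : Torus, ∃ k ≤ n₀ + 1,
        c * h ^ (2 * (n₀ + 1)) ≤ shearPotential u (z, y + ((k * h : ℝ) : Torus))) ?_ ?_ ?_ ?_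
    · exact ⟨1, one_pos, 1, one_pos, by simp⟩
    · rintro A B hAB ⟨c, hc, h₀, hh₀, H⟩
      exact ⟨c, hc, h₀, hh₀, fun y hy => H y (hAB hy)⟩
    · rintro A B ⟨c, hc, h₀, hh₀, H⟩ ⟨c', hc', h₀', hh₀', H'⟩
      refine ⟨min c c', lt_min hc hc', min h₀ h₀', lt_min hh₀ hh₀', ?_⟩
      rintro y (hy | hy) h hh hle z
      · obtain ⟨k, hk, h1⟩ := H y hy h hh (hle.trans (min_le_left _ _)) z
        refine ⟨k, hk, le_trans ?_ h1⟩
        gcongr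
        exact min_le_left _ _
      · obtain ⟨k, hk, h1⟩ := H' y hy h hh (hle.trans (min_le_right _ _)) z
        refine ⟨k, hk, le_trans ?_ h1⟩
        gcongr
        exact min_le_right _ _
    · intro x _
      obtain ⟨j, n, hn, hx⟩ := hn₀ x
      obtain ⟨c, hc, h₀, hh₀, H⟩ := eventually_exists_le_sq_sub (hu j) (Nat.succ_ne_zero n) hx
      refine ⟨_, mem_nhdsWithin_of_mem_nhds H, c, hc, min h₀ 1, lt_min hh₀ one_pos, ?_⟩
      intro y hy h hh hle z
      obtain ⟨k, hk, h1⟩ := hy h hh (hle.trans (min_le_left _ _)) (u j z)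
      refine ⟨k, hk.trans (Nat.succ_le_succ hn), le_trans ?_ (h1.trans
        ((hV z _).le_tsum j fun _ _ => sq_nonneg _))⟩
      -- `h ≤ 1`, so that the highest order of vanishing is the worst case
      have : h ^ (2 * (n₀ + 1)) ≤ h ^ (2 * (n + 1)) :=
        pow_le_pow_of_le_one hh.le (hle.trans (min_le_right _ _)) (by omega)
      gcongr
  obtain ⟨c, hc, h₀, hh₀, H⟩ := key
  exact ⟨c, hc, h₀, hh₀, fun h hh hle p => H p.2 (Set.mem_univ _) h hh hle p.1⟩

/-! ### The lower bound for the energy -/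

/-- A potential which is at least `β` at one of the points `p, p + h e₂, …, p + N h e₂`, for every
`p`, controls `f` together with the weak derivative of `f`: compare `f p` with the value of `f` at
that point, and integrate over `p`. -/
lemma integral_norm_sq_le_of_exists_translate {V : Torus2 → ℝ} (hV0 : ∀ p, 0 ≤ V p) {N : ℕ}
    {β h : ℝ} (hβ : 0 < β)
    (hV : ∀ p : Torus2, ∃ k ≤ N, β ≤ V (p.1, p.2 + ((k * h : ℝ) : Torus)))
    {f f₁ f₂ : Torus2 → ℂ} (hf : InFormDomain V f f₁ f₂) :
    ∫ p, ‖f p‖ ^ 2 ≤ 2 * (N + 1) / β * (∫ p, V p * ‖f p‖ ^ 2) +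
      2 * (N + 1) ^ 3 * h ^ 2 * ∫ p, ‖f₂ p‖ ^ 2 := by
  set τ : ℕ → Torus2 → Torus2 := fun k p => (p.1, p.2 + ((k * h : ℝ) : Torus)) with hτ
  have hτm : ∀ k, MeasurePreserving (τ k) volume volume := fun k => measurePreserving_add_snd _
  have i0 : Integrable (fun p => ‖f p‖ ^ 2) volume := hf.1.memLp.integrable_norm_pow (by simp)
  have i1 : ∀ k, Integrable (fun p => 2 / β * (V (τ k p) * ‖f (τ k p)‖ ^ 2)) volume := fun k =>
    ((hτm k).integrable_comp_of_integrable hf.2).const_mul _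
  have i2 : ∀ k, Integrable (fun p => 2 * ‖f (τ k p) - f p‖ ^ 2) volume := fun k =>
    (((hf.1.memLp.comp_measurePreserving (hτm k)).sub hf.1.memLp).integrable_norm_pow
      (by simp)).const_mul _
  have hpt : ∀ p, ‖f p‖ ^ 2 ≤ ∑ k ∈ Finset.range (N + 1),
      (2 / β * (V (τ k p) * ‖f (τ k p)‖ ^ 2) + 2 * ‖f (τ k p) - f p‖ ^ 2) := by
    intro p
    obtain ⟨k, hk, hle⟩ := hV p
    refine le_trans ?_ (Finset.single_le_sum (fun k _ => ?_)
      (Finset.mem_range.2 (Nat.lt_succ_of_le hk)))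
    · have h1 : ‖f p‖ ≤ ‖f (τ k p)‖ + ‖f (τ k p) - f p‖ := by
        rw [norm_sub_rev]
        simpa using norm_add_le (f (τ k p)) (f p - f (τ k p))
      have h2 : ‖f p‖ ^ 2 ≤ 2 * ‖f (τ k p)‖ ^ 2 + 2 * ‖f (τ k p) - f p‖ ^ 2 := by
        nlinarith [norm_nonneg (f p), sq_nonneg (‖f (τ k p)‖ - ‖f (τ k p) - f p‖)]
      have h3 : 2 * ‖f (τ k p)‖ ^ 2 ≤ 2 / β * (V (τ k p) * ‖f (τ k p)‖ ^ 2) := by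
        rw [← mul_assoc]
        refine mul_le_mul_of_nonneg_right ?_ (sq_nonneg _)
        rw [div_mul_eq_mul_div, le_div_iff₀ hβ]
        exact mul_le_mul_of_nonneg_left hle zero_le_two
      linarith
    · have := hV0 (τ k p)
      positivity
  have e1 : ∀ k : ℕ, ∫ p, V (τ k p) * ‖f (τ k p)‖ ^ 2 = ∫ p, V p * ‖f p‖ ^ 2 := fun k =>
    integral_comp_add_snd (k * h) fun p => V p * ‖f p‖ ^ 2
  have e2 : ∀ k ∈ Finset.range (N + 1),
      ∫ p, ‖f (τ k p) - f p‖ ^ 2 ≤ (N + 1) ^ 2 * h ^ 2 * ∫ p, ‖f₂ p‖ ^ 2 := by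
    intro k hk
    refine (hf.1.integral_norm_translate_sub_sq_le (k * h)).trans ?_
    rw [mul_pow]
    have : (k : ℝ) ≤ N + 1 := by exact_mod_cast (Finset.mem_range.1 hk).le
    have : 0 ≤ ∫ p, ‖f₂ p‖ ^ 2 := integral_nonneg fun _ => sq_nonneg _
    gcongr
  calc ∫ p, ‖f p‖ ^ 2 ≤ ∫ p, ∑ k ∈ Finset.range (N + 1),
        (2 / β * (V (τ k p) * ‖f (τ k p)‖ ^ 2) + 2 * ‖f (τ k p) - f p‖ ^ 2) :=
        integral_mono i0 (integrable_finsetSum _ fun k _ => (i1 k).add (i2 k)) hpt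
    _ = ∑ k ∈ Finset.range (N + 1), (2 / β * (∫ p, V p * ‖f p‖ ^ 2) +
        2 * ∫ p, ‖f (τ k p) - f p‖ ^ 2) := by
        rw [integral_finsetSum (f := fun k p => 2 / β * (V (τ k p) * ‖f (τ k p)‖ ^ 2) +
          2 * ‖f (τ k p) - f p‖ ^ 2) _ fun k _ => (i1 k).add (i2 k)]
        refine Finset.sum_congr rfl fun k _ => ?_
        rw [integral_add (i1 k) (i2 k), integral_const_mul, integral_const_mul, e1]
    _ ≤ ∑ k ∈ Finset.range (N + 1), (2 / β * (∫ p, V p * ‖f p‖ ^ 2) +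
        2 * ((N + 1) ^ 2 * h ^ 2 * ∫ p, ‖f₂ p‖ ^ 2)) := by
        refine Finset.sum_le_sum fun k hk => ?_
        have := e2 k hk
        gcongr
    _ = _ := by
        rw [Finset.sum_const, Finset.card_range, nsmul_eq_mul]
        push_cast
        ring

end ShearSpectrum

end

theorem theorem4p1 {ι : Type*} [Countable ι] (u : ι → ShearSpectrum.Torus → ℝ)
    (hu : ∀ j, ShearSpectrum.SmoothOnTorus (u j))
    (hV : ∀ x y : ShearSpectrum.Torus, Summable (fun j => (u j y - u j x) ^ 2))
    (hcrit : ∀ j, {x | ShearSpectrum.IsIsolatedCriticalPoint (u j) x}.Finite)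
    (n₀ : ℕ)
    (hn₀ : ∀ x : ShearSpectrum.Torus, ∃ j, ∃ n ≤ n₀, ShearSpectrum.torusDeriv (n + 1) (u j) x ≠ 0) :
    ∃ c : ℝ, 0 < c ∧ ∀ᶠ lam : ℝ in Filter.atTop, ∃ μ : ℝ,
      IsLeast {ν : ℝ | ShearSpectrum.IsSchrodingerEigenvalue
        (fun p => lam ^ 2 * ShearSpectrum.shearPotential u p) ν} μ ∧
      c * lam ^ ((2 : ℝ) / ((n₀ : ℝ) + 2)) ≤ μ := by
  open ShearSpectrum in
  have huc := fun j => (hu j).continuous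
  have hVm := measurable_shearPotential huc hV
  obtain ⟨M, O, hO, hOne, hM⟩ := exists_isOpen_shearPotential_le huc hV
  obtain ⟨c, hc, h₀, hh₀, H⟩ := exists_le_shearPotential_translate hu hV hn₀
  set C : ℝ := 2 * ((n₀ + 1 : ℕ) + 1) / c + 2 * ((n₀ + 1 : ℕ) + 1) ^ 3 with hC
  have hCpos : 0 < C := by positivity
  refine ⟨C⁻¹, by positivity, ?_⟩
  have hlim : Tendsto (fun lam : ℝ => lam ^ (-(1 / ((n₀ : ℝ) + 2)))) atTop (𝓝 0) :=
    tendsto_rpow_neg_atTop (by positivity)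
  filter_upwards [hlim.eventually_le_const hh₀, eventually_gt_atTop 0] with lam hlam hpos
  set W : Torus2 → ℝ := fun p => lam ^ 2 * shearPotential u p with hWdef
  have hW0 : ∀ p, 0 ≤ W p := fun p => mul_nonneg (sq_nonneg _) (shearPotential_nonneg u p)
  have hWm : Measurable W := hVm.const_mul _
  obtain ⟨μ, hμ⟩ := exists_isLeast_isSchrodingerEigenvalue hWm hW0
    (exists_inFormDomain_ne_zero hWm hW0 (M := lam ^ 2 * M) hO hOne fun p hp =>
      mul_le_mul_of_nonneg_left (hM p hp) (sq_nonneg _))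
  refine ⟨μ, hμ, ?_⟩
  obtain ⟨f, f₁, f₂, hf0, hf, henergy⟩ := IsSchrodingerEigenvalue.exists_energy_eq hμ.1
  -- the length scale at which `h ^ (-2)` and `lam ^ 2 * h ^ (2 (n₀ + 1))` agree
  set h : ℝ := lam ^ (-(1 / ((n₀ : ℝ) + 2))) with hh
  have hhpos : 0 < h := Real.rpow_pos_of_pos hpos _
  have hscale : lam ^ 2 * h ^ (2 * (n₀ + 1)) = (h ^ 2)⁻¹ := by
    have e : h ^ (n₀ + 2) = lam⁻¹ := by
      rw [hh, ← Real.rpow_natCast, ← Real.rpow_mul hpos.le, ← Real.rpow_neg_one]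
      congr 1
      push_cast
      field_simp
    have e2 : h ^ (2 * (n₀ + 1)) * h ^ 2 = (h ^ (n₀ + 2)) ^ 2 := by ring
    rw [e] at e2
    field_simp
    rw [mul_assoc, e2]
    field_simp
  have hfin : lam ^ ((2 : ℝ) / ((n₀ : ℝ) + 2)) = (h ^ 2)⁻¹ := by
    rw [hh, ← Real.rpow_natCast, ← Real.rpow_mul hpos.le, ← Real.rpow_neg hpos.le]
    congr 1
    push_cast
    ring
  have hmain := integral_norm_sq_le_of_exists_translate (N := n₀ + 1) (h := h) hW0
    (β := lam ^ 2 * (c * h ^ (2 * (n₀ + 1)))) (by positivity) (fun p => by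
      obtain ⟨k, hk, hle⟩ := H h hhpos hlam p
      exact ⟨k, hk, mul_le_mul_of_nonneg_left hle (sq_nonneg _)⟩) hf
  have hβ : lam ^ 2 * (c * h ^ (2 * (n₀ + 1))) = c / h ^ 2 := by
    rw [mul_left_comm, hscale, div_eq_mul_inv]
  rw [hβ] at hmain
  have hfpos := integral_norm_sq_pos hf.1.memLp hf0
  have p1 : 0 ≤ ∫ p, ‖f₁ p‖ ^ 2 := integral_nonneg fun _ => sq_nonneg _
  have p2 : 0 ≤ ∫ p, ‖f₂ p‖ ^ 2 := integral_nonneg fun _ => sq_nonneg _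
  have p3 : 0 ≤ ∫ p, W p * ‖f p‖ ^ 2 := integral_nonneg fun p => mul_nonneg (hW0 p) (sq_nonneg _)
  have hbound : 1 * ∫ p, ‖f p‖ ^ 2 ≤ (C * h ^ 2 * μ) * ∫ p, ‖f p‖ ^ 2 := by
    rw [mul_assoc (C * h ^ 2), ← henergy, one_mul]
    refine hmain.trans ?_
    have a1 : 0 ≤ 2 * (((n₀ + 1 : ℕ) : ℝ) + 1) / c * h ^ 2 := by positivity
    have a2 : 0 ≤ 2 * (((n₀ + 1 : ℕ) : ℝ) + 1) ^ 3 * h ^ 2 := by positivity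
    rw [div_div_eq_mul_div, mul_div_right_comm, hC, add_mul]
    nlinarith [mul_nonneg a1 p1, mul_nonneg a1 p2, mul_nonneg a2 p1, mul_nonneg a2 p3]
  have hone : 1 ≤ C * h ^ 2 * μ := le_of_mul_le_mul_right hbound hfpos
  rw [hfin, ← mul_inv, inv_le_iff_one_le_mul₀ (by positivity)]
  linarith
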